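/- Let $f:\mathbb{R}^d\to\mathbb{R}$ be differentiable and $L$-smooth with $L>0$, i.e. $f(x)\le f(y)+\langle\nabla f(y),x-y\rangle+\frac L2\|x-y\|^2$ for all $x,y$, and $\rho$-quasar convex with $\rho>0$ with respect to a global minimizer $w_*$ of $f$, i.e. $f(w_*)\ge f(w)+\frac1\rho\langle\nabla f(w),w_*-w\rangle$ for all $w$. Let $T_0=0$ and let $T_1<T_2<\cdots$ be random times whose increments $T_1,\,T_2-T_1,\,T_3-T_2,\dots$ are i.i.d. exponential with mean $1$, and let $dN(t)=\sum_{k\ge1}\delta_{T_k}(dt)$ be the associated Poisson point measure. All expectations below are with respect to these random times. (1) Let $\eta_t=\frac{2}{\rho t}$, $\eta'_t=0$, $\gamma_t=\frac1L$, $\gamma'_t=\frac{\rho t}{2L}$, and let $(w_t,z_t)$ be a solution for $t>0$ of the continuized Nesterov process $$dw_t=\eta_t(z_t-w_t)\,dt-\gamma_t\nabla f(w_t)\,dN(t),\qquad dz_t=\eta'_t(w_t-z_t)\,dt-\gamma'_t\nabla f(w_t)\,dN(t),$$ that is, almost surely: between consecutive times $T_k$ one has $\dot w_t=\eta_t(z_t-w_t)$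 and $\dot z_t=\eta'_t(w_t-z_t)$, and at each $T_k$, $k\ge1$, the path is right-continuous with left limits and $w_{T_k}=w_{T_k-}-\gamma_{T_k}\nabla f(w_{T_k-})$, $z_{T_k}=z_{T_k-}-\gamma'_{T_k}\nabla f(w_{T_k-})$. Suppose that $z$ starts right-continuously from a deterministic point $z_0$ at time $0$, and that $w$ has a finite right limit at $0$ (it need not equal $w_0$, since $\eta_t$ is singular at $t=0$). Then for every $t>0$, $f(w_t)-f(w_*)$ is integrable and $$\mathbb{E}[f(w_t)-f(w_*)]\le\frac{2L\|z_0-w_*\|^2}{\rho^2t^2}.$$ (2) Let $\tilde w_0,\tilde z_0\in\mathbb{R}^d$ be arbitrary and, for $k\ge0$, $$\tilde v_k=\tilde w_k+\tau_k(\tilde z_k-\tilde w_k),\quad \tilde w_{k+1}=\tilde v_k-\tilde\gamma_{k+1}\nabla f(\tilde v_k),\quad \tilde z_{k+1}=\tilde z_k+\tau'_k(\tilde v_k-\tilde z_k)-\tilde\gamma'_{k+1}\nabla f(\tilde v_k),$$ with $\tau_k=1-\left(\frac{T_k}{T_{k+1}}\right)^{2/\rho}$, $\tau'_k=0$, $\tilde\gamma_k=\frac1L$,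 $\tilde\gamma'_k=\frac{\rho T_k}{2L}$. Then for every $k\ge0$, $T_k^2(f(\tilde w_k)-f(w_*))$ is integrable and $$\mathbb{E}\left[T_k^2\left(f(\tilde w_k)-f(w_*)\right)\right]\le\frac{2L\|\tilde z_0-w_*\|^2}{\rho^2}.$$ -/

import Mathlib

open MeasureTheory ProbabilityTheory Filter Topology

/-- `f` is (differentiable and) `L`-smooth: it satisfies the global quadratic upper bound
`f x ≤ f y + ⟨∇f(y), x - y⟩ + (L/2) ‖x - y‖²`. -/
structure IsLSmooth {d : ℕ} (L : ℝ) (f : EuclideanSpace ℝ (Fin d) → ℝ) : Prop where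
  differentiable : Differentiable ℝ f
  upper_bound : ∀ x y : EuclideanSpace ℝ (Fin d),
    f x ≤ f y + inner ℝ (gradient f y) (x - y) + L / 2 * ‖x - y‖ ^ 2

/-- `f` is `ρ`-quasar convex with respect to its global minimizer `wstar`. -/
structure IsQuasarConvex {d : ℕ} (ρ : ℝ) (f : EuclideanSpace ℝ (Fin d) → ℝ)
    (wstar : EuclideanSpace ℝ (Fin d)) : Prop where
  isMin : ∀ w : EuclideanSpace ℝ (Fin d), f wstar ≤ f w
  quasar : ∀ w : EuclideanSpace ℝ (Fin d),
    f w + 1 / ρ * inner ℝ (gradient f w) (wstar - w) ≤ f wstar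

/-- `T 1, T 2, …` are the successive points of a Poisson point process of rate `1` on `(0, ∞)`
(with the convention `T 0 = 0`): the increments `T 1 - T 0, T 2 - T 1, …` are independent and
exponentially distributed with mean `1`. -/
structure IsPoissonArrivals {Ω : Type*} [MeasurableSpace Ω] (P : Measure Ω)
    (T : ℕ → Ω → ℝ) : Prop where
  measurable : ∀ k, Measurable (T k)
  zero : ∀ ω, T 0 ω = 0
  indep : iIndepFun (fun (k : ℕ) (ω : Ω) => T (k + 1) ω - T k ω) P
  law : ∀ k, HasLaw (fun ω => T (k + 1) ω - T k ω) (expMeasure 1) P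

/-- A path `(w, z)` of the continuized Nesterov dynamics
`dw = η (z - w) dt - γ ∇f(w) dN`, `dz = η' (w - z) dt - γ' ∇f(w) dN` at positive times, where
`dN = ∑_{k ≥ 1} δ_{T k}` and `0 = T 0 < T 1 < T 2 < …`: the drift equations hold between
consecutive points, the path is right-continuous with left limits at each point `T k`, `k ≥ 1`,
and there it jumps by a gradient step evaluated at the left limit of `w`. -/
structure IsContinuizedPath {d : ℕ} (f : EuclideanSpace ℝ (Fin d) → ℝ) (η η' γ γ' : ℝ → ℝ)
    (T : ℕ → ℝ) (w z : ℝ → EuclideanSpace ℝ (Fin d)) : Prop where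
  drift_w : ∀ k, ∀ t ∈ Set.Ioo (T k) (T (k + 1)), HasDerivAt w (η t • (z t - w t)) t
  drift_z : ∀ k, ∀ t ∈ Set.Ioo (T k) (T (k + 1)), HasDerivAt z (η' t • (w t - z t)) t
  rightCont_w : ∀ k, ContinuousWithinAt w (Set.Ici (T (k + 1))) (T (k + 1))
  rightCont_z : ∀ k, ContinuousWithinAt z (Set.Ici (T (k + 1))) (T (k + 1))
  jump : ∀ k, ∃ wl zl : EuclideanSpace ℝ (Fin d),
    Tendsto w (𝓝[<] (T (k + 1))) (𝓝 wl) ∧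
    Tendsto z (𝓝[<] (T (k + 1))) (𝓝 zl) ∧
    w (T (k + 1)) = wl - γ (T (k + 1)) • gradient f wl ∧
    z (T (k + 1)) = zl - γ' (T (k + 1)) • gradient f wl

/-- The initial condition at time `0`: `z` starts (right-continuously) from `z0`, and `w` has a
finite right limit at `0`. This right limit is not required to be the value `w 0`, because the
coefficient `η` may be singular at time `0`; paths `w` that are right-continuous at `0` are
included. -/
structure StartsFrom {d : ℕ} (w z : ℝ → EuclideanSpace ℝ (Fin d))
    (z0 : EuclideanSpace ℝ (Fin d)) : Prop where
  init_z : z 0 = z0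
  rightCont_z : ContinuousWithinAt z (Set.Ici 0) 0
  rightLim_w : ∃ a : EuclideanSpace ℝ (Fin d), Tendsto w (𝓝[>] 0) (𝓝 a)

/-- The discrete-time algorithm with (per-path) parameters `τ, τ', γ, γ'`. -/
structure IsDiscreteNesterov {d : ℕ} (f : EuclideanSpace ℝ (Fin d) → ℝ) (τ τ' γ γ' : ℕ → ℝ)
    (w v z : ℕ → EuclideanSpace ℝ (Fin d)) : Prop where
  step_v : ∀ k, v k = w k + τ k • (z k - w k)
  step_w : ∀ k, w (k + 1) = v k - γ (k + 1) • gradient f (v k)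
  step_z : ∀ k, z (k + 1) = z k + τ' k • (v k - z k) - γ' (k + 1) • gradient f (v k)

/-! The energy `u ^ 2 * (f w - f wstar) + 2 * L / ρ ^ 2 * ‖z - wstar‖ ^ 2` is a supermartingale.
Just before a jump at time u, let w = v. The drift makes the energy grow at rate 2u(f v - f wstar) +
(2u/ρ)⟨∇f v, z - v⟩. Arrivals come at rate 1, and a jump changes the energy by at most -(2u/ρ)⟨∇f v,
z - wstar⟩. The sum is 2u(f v - f wstar + (1/ρ)⟨∇f v, wstar - v⟩), nonpositive by quasar convexity.
At time 0 only the term in `z0` is left, which gives the constant.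

No stochastic calculus is needed. The drift is solved explicitly, so the process stopped at a
horizon is a Markov chain driven by i.i.d. exponential waiting times.
`lintegral_nesterovLyapunov_stoppedStep_le` gives the mean decrease over one step, and
`lintegral_drivenChain_le` iterates it by independence. Fatou's lemma then yields both claims: in
continuous time the horizon is t and the number of steps grows; in discrete time the number of steps
is k and the horizon grows. -/

/-! ### Integration against the exponential law -/

section Exponential

theorem expMeasure_one_Iic (b : ℝ) (hb : 0 ≤ b) :
    expMeasure 1 (Set.Iic b) = ENNReal.ofReal (1 - Real.exp (-b)) := by
  have := isProbabilityMeasure_expMeasure one_pos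
  rw [← ofReal_cdf, cdf_expMeasure_eq one_pos, if_pos hb, one_mul]

theorem expMeasure_one_Ioi (b : ℝ) (hb : 0 ≤ b) :
    expMeasure 1 (Set.Ioi b) = ENNReal.ofReal (Real.exp (-b)) := by
  have := isProbabilityMeasure_expMeasure one_pos
  rw [← Set.compl_Iic, prob_compl_eq_one_sub measurableSet_Iic, expMeasure_one_Iic b hb,
    ← ENNReal.ofReal_one, ← ENNReal.ofReal_sub]
  · simp
  · simpa using hb

theorem ae_pos_expMeasure_one : ∀ᵐ x ∂expMeasure 1, 0 < x := by
  rw [ae_iff]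
  simp only [not_lt]
  exact (expMeasure_one_Iic 0 le_rfl).trans (by simp)

/-- Integration by parts against the exponential law, in inequality form: an exponential clock
stopped at time `b` turns `H - H'` into at most the initial value of `H`. -/
theorem lintegral_expMeasure_le_of_hasDerivAt {b : ℝ} (hb : 0 ≤ b) {F H H' : ℝ → ℝ}
    (hFm : Measurable F) (hF0 : ∀ x, 0 ≤ F x) (hH0 : 0 ≤ H b)
    (hc : ContinuousOn H (Set.Icc 0 b)) (hd : ∀ x ∈ Set.Ioo 0 b, HasDerivAt H (H' x) x)
    (hle : ∀ x ∈ Set.Ioo 0 b, F x ≤ H x - H' x) (hlt : ∀ x, b < x → F x ≤ H b) :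
    ∫⁻ x, ENNReal.ofReal (F x) ∂expMeasure 1 ≤ ENNReal.ofReal (H 0) := by
  set G : ℝ → ℝ := fun x => -(Real.exp (-x) * H x) with hG
  set G' : ℝ → ℝ := fun x => Real.exp (-x) * (H x - H' x) with hG'
  have hGc : ContinuousOn G (Set.Icc 0 b) :=
    ((Real.continuous_exp.comp continuous_neg).continuousOn.mul hc).neg
  have hGd : ∀ x ∈ Set.Ioo 0 b, HasDerivAt G (G' x) x := by
    intro x hx
    have h1 : HasDerivAt (fun x : ℝ => Real.exp (-x)) (Real.exp (-x) * (-1)) x :=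
      (hasDerivAt_neg x).exp
    refine (h1.mul (hd x hx)).neg.congr_deriv ?_
    simp only [hG']; ring
  have hG0 : ∀ x ∈ Set.Ioo 0 b, 0 ≤ G' x := fun x hx =>
    mul_nonneg (Real.exp_pos _).le ((hF0 x).trans (hle x hx))
  -- Nothing is assumed about integrability of `H'`; it is the sign of `G'`, inherited from `F`,
  -- that makes `G'` integrable.
  have hint := intervalIntegral.integrableOn_deriv_of_nonneg hGc hGd hG0
  have hsplit : (Set.univ : Set ℝ) = Set.Iic 0 ∪ (Set.Ioc 0 b ∪ Set.Ioi b) := by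
    ext x; simp; rcases le_or_gt x 0 with h | h
    · simp [h]
    · rcases le_or_gt x b with h' | h' <;> simp [h, h']
  have hzero : ∫⁻ x in Set.Iic 0, ENNReal.ofReal (F x) ∂expMeasure 1 = 0 := by
    rw [Measure.restrict_eq_zero.2, lintegral_zero_measure]
    rw [expMeasure_one_Iic 0 le_rfl]; simp
  have hmid : ∫⁻ x in Set.Ioc 0 b, ENNReal.ofReal (F x) ∂expMeasure 1
      ≤ ENNReal.ofReal (H 0 - Real.exp (-b) * H b) := by
    have hval : ∫ x in Set.Ioc 0 b, G' x = H 0 - Real.exp (-b) * H b := by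
      rw [← intervalIntegral.integral_of_le hb,
        intervalIntegral.integral_eq_sub_of_hasDerivAt_of_le hb hGc hGd
          ((intervalIntegrable_iff_integrableOn_Ioc_of_le hb).2 hint)]
      simp [hG]; ring
    have hae : ∀ᵐ x ∂(volume.restrict (Set.Ioc (0 : ℝ) b)), x ∈ Set.Ioo 0 b := by
      rw [← Measure.restrict_congr_set (Ioo_ae_eq_Ioc (a := (0 : ℝ)) (b := b) (μ := volume))]
      exact ae_restrict_mem measurableSet_Ioo
    rw [← hval, ofReal_integral_eq_lintegral_ofReal hint (hae.mono hG0)]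
    change ∫⁻ x in Set.Ioc 0 b, ENNReal.ofReal (F x) ∂(volume.withDensity (exponentialPDF 1)) ≤ _
    rw [setLIntegral_withDensity_eq_setLIntegral_mul _
      (show Measurable (exponentialPDF 1) from
        (measurable_exponentialPDFReal 1).ennreal_ofReal) hFm.ennreal_ofReal measurableSet_Ioc]
    refine lintegral_mono_ae (hae.mono fun x hx => ?_)
    simp only [Pi.mul_apply]
    rw [exponentialPDF_of_nonneg hx.1.le, ← ENNReal.ofReal_mul (by positivity)]
    refine ENNReal.ofReal_le_ofReal ?_
    simp only [one_mul, hG']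
    exact mul_le_mul_of_nonneg_left (hle x hx) (Real.exp_pos _).le
  have htail : ∫⁻ x in Set.Ioi b, ENNReal.ofReal (F x) ∂expMeasure 1
      ≤ ENNReal.ofReal (Real.exp (-b) * H b) := by
    calc ∫⁻ x in Set.Ioi b, ENNReal.ofReal (F x) ∂expMeasure 1
        ≤ ∫⁻ x in Set.Ioi b, ENNReal.ofReal (H b) ∂expMeasure 1 :=
          setLIntegral_mono measurable_const fun x hx => ENNReal.ofReal_le_ofReal (hlt x hx)
      _ = ENNReal.ofReal (Real.exp (-b) * H b) := by
          rw [setLIntegral_const, expMeasure_one_Ioi b hb, mul_comm,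
            ← ENNReal.ofReal_mul (Real.exp_pos _).le]
  have hnn : 0 ≤ H 0 - Real.exp (-b) * H b := by
    have := (monotoneOn_of_deriv_nonneg (convex_Icc 0 b) hGc
      (fun x hx => (hGd x (by simpa using hx)).differentiableAt.differentiableWithinAt)
      (fun x hx => by
        rw [interior_Icc] at hx
        rw [(hGd x hx).deriv]; exact hG0 x hx)) ⟨le_rfl, hb⟩ ⟨hb, le_rfl⟩ hb
    simp only [hG, neg_zero, Real.exp_zero, one_mul] at this
    linarith
  rw [← setLIntegral_univ, hsplit]
  calc _ ≤ _ := (lintegral_union_le _ _ _).trans (add_le_add le_rfl (lintegral_union_le _ _ _))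
    _ ≤ 0 + (ENNReal.ofReal (H 0 - Real.exp (-b) * H b)
          + ENNReal.ofReal (Real.exp (-b) * H b)) :=
        add_le_add hzero.le (add_le_add hmid htail)
    _ = ENNReal.ofReal (H 0) := by
        rw [zero_add, ← ENNReal.ofReal_add hnn (mul_nonneg (Real.exp_pos _).le hH0)]
        simp

end Exponential

/-! ### The Lyapunov function and its mean decrease over one step -/

section Lyapunov

variable {d : ℕ}

/-- The drift part of the continuized Nesterov dynamics between times `s` and `u`, started at `w`
with the (constant) companion point `z`. -/
noncomputable def nesterovFlow (ρ s u : ℝ) (w z : EuclideanSpace ℝ (Fin d)) :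
    EuclideanSpace ℝ (Fin d) :=
  z + (s / u) ^ (2 / ρ) • (w - z)

/-- The Lyapunov function of the continuized Nesterov dynamics at `(time, w, z)`. -/
noncomputable def nesterovLyapunov (f : EuclideanSpace ℝ (Fin d) → ℝ) (L ρ : ℝ)
    (wstar : EuclideanSpace ℝ (Fin d))
    (x : ℝ × EuclideanSpace ℝ (Fin d) × EuclideanSpace ℝ (Fin d)) : ℝ :=
  x.1 ^ 2 * (f x.2.1 - f wstar) + 2 * L / ρ ^ 2 * ‖x.2.2 - wstar‖ ^ 2

/-- The gradient jump at time `u` from the left limits `(v, z)`. -/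
noncomputable def nesterovJump (f : EuclideanSpace ℝ (Fin d) → ℝ) (L ρ u : ℝ)
    (v z : EuclideanSpace ℝ (Fin d)) :
    ℝ × EuclideanSpace ℝ (Fin d) × EuclideanSpace ℝ (Fin d) :=
  (u, v - (1 / L) • gradient f v, z - (ρ * u / (2 * L)) • gradient f v)

/-- One transition of the dynamics stopped at time `t`, after a waiting time `e`. -/
noncomputable def stoppedStep (f : EuclideanSpace ℝ (Fin d) → ℝ) (L ρ t : ℝ)
    (x : ℝ × EuclideanSpace ℝ (Fin d) × EuclideanSpace ℝ (Fin d)) (e : ℝ) :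
    ℝ × EuclideanSpace ℝ (Fin d) × EuclideanSpace ℝ (Fin d) :=
  if x.1 + e ≤ t then
    nesterovJump f L ρ (x.1 + e) (nesterovFlow ρ x.1 (x.1 + e) x.2.1 x.2.2) x.2.2
  else (t, nesterovFlow ρ x.1 t x.2.1 x.2.2, x.2.2)

variable {f : EuclideanSpace ℝ (Fin d) → ℝ} {L ρ : ℝ} {wstar : EuclideanSpace ℝ (Fin d)}

theorem nesterovLyapunov_nonneg (hL : 0 < L) (hmin : ∀ w, f wstar ≤ f w)
    (x : ℝ × EuclideanSpace ℝ (Fin d) × EuclideanSpace ℝ (Fin d)) :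
    0 ≤ nesterovLyapunov f L ρ wstar x := by
  have := sub_nonneg.2 (hmin x.2.1)
  unfold nesterovLyapunov; positivity

theorem nesterovFlow_self {s : ℝ} (hs : 0 < s) (w z : EuclideanSpace ℝ (Fin d)) :
    nesterovFlow ρ s s w z = w := by
  simp [nesterovFlow, div_self hs.ne']

theorem IsLSmooth.gradient_step_le (hL : 0 < L) (hf : IsLSmooth L f)
    (v : EuclideanSpace ℝ (Fin d)) :
    f (v - (1 / L) • gradient f v) ≤ f v - 1 / (2 * L) * ‖gradient f v‖ ^ 2 := by
  refine (hf.upper_bound _ v).trans (le_of_eq ?_)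
  rw [sub_sub_cancel_left, inner_neg_right, inner_smul_right, real_inner_self_eq_norm_sq,
    norm_neg, norm_smul, Real.norm_of_nonneg (by positivity)]
  field_simp; ring

/-- The step sizes are tuned so that the terms in ‖∇f v‖² cancel: the descent of `f` gains u²/(2L),
exactly what expanding the square in z costs. -/
theorem nesterovLyapunov_jump_le (hL : 0 < L) (hρ : ρ ≠ 0) (hf : IsLSmooth L f)
    (u : ℝ) (v z : EuclideanSpace ℝ (Fin d)) :
    nesterovLyapunov f L ρ wstar (nesterovJump f L ρ u v z) ≤
      u ^ 2 * (f v - f wstar) + 2 * L / ρ ^ 2 * ‖z - wstar‖ ^ 2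
        - 2 * u / ρ * inner ℝ (gradient f v) (z - wstar) := by
  have h := mul_le_mul_of_nonneg_left (hf.gradient_step_le hL v) (sq_nonneg u)
  simp only [nesterovLyapunov, nesterovJump]
  have e : ‖z - (ρ * u / (2 * L)) • gradient f v - wstar‖ ^ 2 = ‖z - wstar‖ ^ 2
      - ρ * u / L * inner ℝ (gradient f v) (z - wstar)
      + (ρ * u / (2 * L)) ^ 2 * ‖gradient f v‖ ^ 2 := by
    rw [sub_right_comm, norm_sub_sq_real, inner_smul_right, norm_smul, mul_pow, Real.norm_eq_abs,
      sq_abs, real_inner_comm]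
    ring
  rw [e]
  have : 2 * L / ρ ^ 2 * (‖z - wstar‖ ^ 2
      - ρ * u / L * inner ℝ (gradient f v) (z - wstar)
      + (ρ * u / (2 * L)) ^ 2 * ‖gradient f v‖ ^ 2) = 2 * L / ρ ^ 2 * ‖z - wstar‖ ^ 2
      - 2 * u / ρ * inner ℝ (gradient f v) (z - wstar)
      + u ^ 2 * (1 / (2 * L) * ‖gradient f v‖ ^ 2) := by
    field_simp
  rw [this]
  linarith

theorem hasDerivAt_nesterovFlow {s u : ℝ} (hs : 0 ≤ s) (hu : 0 < u) (hρ : 0 < ρ)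
    (w z : EuclideanSpace ℝ (Fin d)) :
    HasDerivAt (fun u => nesterovFlow ρ s u w z)
      ((2 / (ρ * u)) • (z - nesterovFlow ρ s u w z)) u := by
  have hr : 2 / ρ ≠ 0 := by positivity
  rcases hs.eq_or_lt with rfl | hs
  -- From time 0 the flow sits at `z` whatever `w` is: this is the effect of the singular
  -- coefficient.
  · simpa [nesterovFlow, Real.zero_rpow hr] using hasDerivAt_const u z
  · have h1 : HasDerivAt (fun u : ℝ => (s / u) ^ (2 / ρ))
        (-(2 / (ρ * u)) * (s / u) ^ (2 / ρ)) u := by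
      have h2 : HasDerivAt (fun u : ℝ => s / u) (-s / u ^ 2) u := by
        simpa [div_eq_mul_inv, neg_mul] using (hasDerivAt_inv hu.ne').const_mul s
      refine (h2.rpow_const (p := 2 / ρ) (Or.inl (by positivity))).congr_deriv ?_
      rw [Real.rpow_sub_one (by positivity)]
      field_simp
    refine ((h1.smul_const (w - z)).const_add z).congr_deriv ?_
    simp only [nesterovFlow]
    module

theorem continuousOn_nesterovFlow {s : ℝ} (hs : 0 ≤ s) (hρ : 0 < ρ)
    (w z : EuclideanSpace ℝ (Fin d)) :
    ContinuousOn (fun u => nesterovFlow ρ s u w z) (Set.Ici s) := by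
  rcases hs.eq_or_lt with rfl | hs
  -- At `u = 0` the convention 0 / 0 = 0 keeps the flow equal to `z`, hence constant up to the
  -- endpoint.
  · have hr : 2 / ρ ≠ 0 := by positivity
    simpa [nesterovFlow, Real.zero_rpow hr] using continuousOn_const
  · exact fun u hu => (hasDerivAt_nesterovFlow hs.le (hs.trans_le hu) hρ w
      z).continuousAt.continuousWithinAt

theorem measurable_gradient (f : EuclideanSpace ℝ (Fin d) → ℝ) : Measurable (gradient f) :=
  (InnerProductSpace.toDual ℝ (EuclideanSpace ℝ (Fin d))).symm.continuous.measurable.comp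
    (measurable_fderiv ℝ f)

theorem measurable_stoppedStep (f : EuclideanSpace ℝ (Fin d) → ℝ) (L ρ t : ℝ) :
    Measurable (fun p : (ℝ × EuclideanSpace ℝ (Fin d) × EuclideanSpace ℝ (Fin d)) × ℝ =>
      stoppedStep f L ρ t p.1 p.2) := by
  have hg := measurable_gradient f
  unfold stoppedStep nesterovJump nesterovFlow
  refine Measurable.ite (measurableSet_le (by fun_prop) measurable_const) ?_ ?_ <;> fun_prop

theorem measurable_nesterovLyapunov (hf : IsLSmooth L f) :
    Measurable (nesterovLyapunov f L ρ wstar) := by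
  have := hf.differentiable.continuous.measurable
  unfold nesterovLyapunov; fun_prop

/-- This is the generator inequality in integrated form. In the integration by parts, `H` is the
energy just before a jump at `s + e` and `F` the energy after the stopped step. -/
theorem lintegral_nesterovLyapunov_stoppedStep_le (hL : 0 < L) (hρ : 0 < ρ) (hf : IsLSmooth L f)
    (hq : IsQuasarConvex ρ f wstar) {t : ℝ}
    (x : ℝ × EuclideanSpace ℝ (Fin d) × EuclideanSpace ℝ (Fin d)) (hx : x.1 ∈ Set.Icc 0 t) :
    ∫⁻ e, ENNReal.ofReal (nesterovLyapunov f L ρ wstar (stoppedStep f L ρ t x e)) ∂expMeasure 1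
      ≤ ENNReal.ofReal (nesterovLyapunov f L ρ wstar x) := by
  obtain ⟨s, w, z⟩ := x
  obtain ⟨hs, hst⟩ := hx
  simp only at hs hst
  set v : ℝ → EuclideanSpace ℝ (Fin d) := fun u => nesterovFlow ρ s u w z with hv
  set C := 2 * L / ρ ^ 2 * ‖z - wstar‖ ^ 2 with hC
  have hC0 : 0 ≤ C := by positivity
  have h0 : (s + 0) ^ 2 * (f (v (s + 0)) - f wstar) + C = nesterovLyapunov f L ρ wstar (s, w, z) := by
    simp only [nesterovLyapunov, add_zero]
    -- For s = 0 the flow does not start at `w`, but the factor s² removes the objective gap.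
    rcases hs.eq_or_lt with rfl | hs
    · simp [hC]
    · simp [hv, nesterovFlow_self hs, hC]
  rw [← h0]
  refine lintegral_expMeasure_le_of_hasDerivAt (b := t - s) (sub_nonneg.2 hst)
    (H := fun e => (s + e) ^ 2 * (f (v (s + e)) - f wstar) + C)
    (H' := fun e => 2 * (s + e) * (f (v (s + e)) - f wstar) + (s + e) ^ 2 *
      inner ℝ (gradient f (v (s + e))) ((2 / (ρ * (s + e))) • (z - v (s + e)))) ?_ ?_ ?_ ?_ ?_ ?_ ?_
  · exact (measurable_nesterovLyapunov hf).comp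
      ((measurable_stoppedStep f L ρ t).comp measurable_prodMk_left)
  · exact fun e => nesterovLyapunov_nonneg hL hq.isMin _
  · have := sub_nonneg.2 (hq.isMin (v (s + (t - s))))
    positivity
  · have hvc : ContinuousOn (fun e => v (s + e)) (Set.Icc 0 (t - s)) :=
      (continuousOn_nesterovFlow hs hρ w z).comp (by fun_prop) fun e he => by
        simpa using he.1
    have := hf.differentiable.continuous.comp_continuousOn hvc
    exact ((by fun_prop : ContinuousOn (fun e : ℝ => (s + e) ^ 2) _).mul
      (this.sub continuousOn_const)).add continuousOn_const
  · intro e he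
    have hu : 0 < s + e := by linarith [he.1]
    have hvd : HasDerivAt (fun e => v (s + e)) ((2 / (ρ * (s + e))) • (z - v (s + e))) e :=
      (hasDerivAt_nesterovFlow hs hu hρ w z).comp_const_add s e
    have hfd : HasDerivAt (fun e => f (v (s + e)))
        (inner ℝ (gradient f (v (s + e))) ((2 / (ρ * (s + e))) • (z - v (s + e)))) e := by
      exact (hf.differentiable (v (s + e))).hasGradientAt.hasFDerivAt.comp_hasDerivAt e hvd
    have hsq : HasDerivAt (fun e : ℝ => (s + e) ^ 2) (2 * (s + e)) e := by
      simpa using HasDerivAt.fun_pow ((hasDerivAt_id e).const_add s) 2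
    exact (hsq.mul (hfd.sub_const _)).add_const C
  · intro e he
    have hu : 0 < s + e := by linarith [he.1]
    have hle : s + e ≤ t := by linarith [he.2]
    simp only [stoppedStep, if_pos hle]
    refine (nesterovLyapunov_jump_le hL hρ.ne' hf _ _ _).trans ?_
    change (s + e) ^ 2 * (f (v (s + e)) - f wstar) + C
      - 2 * (s + e) / ρ * inner ℝ (gradient f (v (s + e))) (z - wstar) ≤ _
    have hqv := hq.quasar (v (s + e))
    have e1 : (s + e) ^ 2 * inner ℝ (gradient f (v (s + e))) ((2 / (ρ * (s + e))) • (z - v (s + e)))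
        = 2 * (s + e) * (1 / ρ * inner ℝ (gradient f (v (s + e))) (z - v (s + e))) := by
      rw [inner_smul_right]; field_simp
    have e2 : inner ℝ (gradient f (v (s + e))) (z - wstar) =
        inner ℝ (gradient f (v (s + e))) (z - v (s + e))
          - inner ℝ (gradient f (v (s + e))) (wstar - v (s + e)) := by
      rw [← inner_sub_right, sub_sub_sub_cancel_right]
    have := mul_le_mul_of_nonneg_left hqv (by positivity : 0 ≤ 2 * (s + e))
    rw [e1, e2]
    have e3 : ∀ a b : ℝ, 2 * (s + e) / ρ * (a - b) =
      2 * (s + e) * (1 / ρ * a) - 2 * (s + e) * (1 / ρ * b) := by intros; ring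
    rw [e3]
    linarith
  · intro e he
    have : ¬ s + e ≤ t := by linarith
    simp only [stoppedStep, if_neg this, nesterovLyapunov, add_sub_cancel]
    exact le_rfl

end Lyapunov

/-! ### Markov chains driven by independent inputs -/

section DrivenChain

variable {S α Ω : Type*}

/-- The sequence of states obtained from `x0` by iterating `step` along the inputs `e`. -/
def drivenChain (step : S → α → S) (x0 : S) (e : ℕ → α) : ℕ → S
  | 0 => x0
  | n + 1 => step (drivenChain step x0 e n) (e n)

variable [MeasurableSpace S] [MeasurableSpace α] {step : S → α → S} {x0 : S} {X : ℕ → Ω → α}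

/-- The state at step n uses only the inputs before n; independence from input n follows. -/
theorem measurable_drivenChain_iSup_comap (hstep : Measurable (fun p : S × α => step p.1 p.2))
    (n : ℕ) :
    Measurable[⨆ i ∈ Set.Iio n, MeasurableSpace.comap (X i) inferInstance]
      (fun ω => drivenChain step x0 (fun i => X i ω) n) := by
  induction n with
  | zero => exact measurable_const
  | succ n ih =>
    refine Measurable.comp hstep (Measurable.prodMk ?_ ?_)
    · refine ih.mono (biSup_mono fun i hi => ?_) le_rfl
      exact lt_trans hi (Nat.lt_succ_self n)
    · refine (comap_measurable (X n)).mono ?_ le_rfl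
      exact le_biSup (fun i => MeasurableSpace.comap (X i) inferInstance)
        (show n ∈ Set.Iio (n + 1) from Nat.lt_succ_self n)

variable [MeasurableSpace Ω] {P : Measure Ω} {μ : Measure α}

theorem measurable_drivenChain (hstep : Measurable (fun p : S × α => step p.1 p.2))
    (hX : ∀ i, Measurable (X i)) (n : ℕ) :
    Measurable (fun ω => drivenChain step x0 (fun i => X i ω) n) :=
  (measurable_drivenChain_iSup_comap hstep n).mono
    (iSup₂_le fun i _ => (hX i).comap_le) le_rfl

theorem indepFun_drivenChain (hstep : Measurable (fun p : S × α => step p.1 p.2))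
    (hX : ∀ i, Measurable (X i)) (hind : iIndepFun X P) (n : ℕ) :
    IndepFun (fun ω => drivenChain step x0 (fun i => X i ω) n) (X n) P := by
  have h := indep_iSup_of_disjoint (fun i => (hX i).comap_le) hind
    (S := Set.Iio n) (T := {n}) (by simp)
  rw [IndepFun_iff_Indep]
  refine indep_of_indep_of_le_left (indep_of_indep_of_le_right h ?_)
    (measurable_drivenChain_iSup_comap hstep n).comap_le
  simp

/-- A function `V` that does not increase in mean under one random step from any state of an
invariant set does not increase in mean along the chain. -/
theorem lintegral_drivenChain_le [IsProbabilityMeasure P] [SFinite μ]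
    (hstep : Measurable (fun p : S × α => step p.1 p.2))
    (hX : ∀ i, Measurable (X i)) (hind : iIndepFun X P) (hlaw : ∀ i, HasLaw (X i) μ P)
    {V : S → ENNReal} (hV : Measurable V) {A : Set S} (hx0 : x0 ∈ A)
    {B : Set α} (hB : ∀ᵐ e ∂μ, e ∈ B) (hAB : ∀ x ∈ A, ∀ e ∈ B, step x e ∈ A)
    (hdec : ∀ x ∈ A, ∫⁻ e, V (step x e) ∂μ ≤ V x) (n : ℕ) :
    ∫⁻ ω, V (drivenChain step x0 (fun i => X i ω) n) ∂P ≤ V x0 := by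
  have hXB : ∀ᵐ ω ∂P, ∀ i, X i ω ∈ B := ae_all_iff.2 fun i =>
    ae_of_ae_map (hlaw i).aemeasurable ((hlaw i).map_eq.symm ▸ hB)
  have hmem : ∀ᵐ ω ∂P, ∀ n, drivenChain step x0 (fun i => X i ω) n ∈ A := by
    filter_upwards [hXB] with ω hω n
    induction n with
    | zero => exact hx0
    | succ n ih => exact hAB _ ih _ (hω n)
  induction n with
  | zero => simp [drivenChain]
  | succ n ih =>
    have hσ := measurable_drivenChain (x0 := x0) hstep hX n
    have hmap := (indepFun_iff_map_prod_eq_prod_map_map hσ.aemeasurable (hX n).aemeasurable).1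
      (indepFun_drivenChain (x0 := x0) hstep hX hind n)
    have hVs : Measurable (fun p : S × α => V (step p.1 p.2)) := hV.comp hstep
    calc ∫⁻ ω, V (drivenChain step x0 (fun i => X i ω) (n + 1)) ∂P
        = ∫⁻ p, V (step p.1 p.2)
            ∂(P.map fun ω => (drivenChain step x0 (fun i => X i ω) n, X n ω)) :=
          (lintegral_map hVs (hσ.prodMk (hX n))).symm
      -- By independence the joint law is a product, so Tonelli freezes the state while input n is
      -- averaged.
      _ = ∫⁻ ω, ∫⁻ e, V (step (drivenChain step x0 (fun i => X i ω) n) e) ∂μ ∂P := by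
          rw [hmap, (hlaw n).map_eq, lintegral_prod _ hVs.aemeasurable,
            lintegral_map hVs.lintegral_prod_right' hσ]
      _ ≤ ∫⁻ ω, V (drivenChain step x0 (fun i => X i ω) n) ∂P :=
          lintegral_mono_ae (hmem.mono fun ω hω => hdec _ (hω n))
      _ ≤ V x0 := ih

end DrivenChain

/-! ### Passage to the limit -/

section Limit

variable {S Ω : Type*} [MeasurableSpace Ω] {P : Measure Ω}

/-- Fatou's lemma: the bound passes to the limit without a dominating function or measurability of
`Z`. -/
theorem lintegral_le_of_eventually_eq [MeasurableSpace S] {Y : ℕ → Ω → S} {Z : Ω → S}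
    {V : S → ENNReal} (hV : Measurable V) (hY : ∀ n, Measurable (Y n))
    (hYZ : ∀ᵐ ω ∂P, ∀ᶠ n in atTop, Y n ω = Z ω) {C : ENNReal}
    (hC : ∀ n, ∫⁻ ω, V (Y n ω) ∂P ≤ C) :
    ∫⁻ ω, V (Z ω) ∂P ≤ C := by
  calc ∫⁻ ω, V (Z ω) ∂P = ∫⁻ ω, liminf (fun n => V (Y n ω)) atTop ∂P := by
        refine lintegral_congr_ae (hYZ.mono fun ω hω => ?_)
        have : Tendsto (fun n => V (Y n ω)) atTop (𝓝 (V (Z ω))) :=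
          tendsto_const_nhds.congr' (hω.mono fun n hn => by simp only [hn])
        exact this.liminf_eq.symm
    _ ≤ liminf (fun n => ∫⁻ ω, V (Y n ω) ∂P) atTop :=
        lintegral_liminf_le fun n => hV.comp (hY n)
    _ ≤ C := (liminf_le_liminf (Eventually.of_forall hC)).trans (liminf_const C).le

theorem integrable_and_integral_le_of_lintegral_le {X : Ω → ℝ} (hX : AEMeasurable X P)
    (h0 : ∀ ω, 0 ≤ X ω) {C : ℝ} (hC : 0 ≤ C)
    (h : ∫⁻ ω, ENNReal.ofReal (X ω) ∂P ≤ ENNReal.ofReal C) :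
    Integrable X P ∧ ∫ ω, X ω ∂P ≤ C := by
  have h0' : 0 ≤ᵐ[P] X := ae_of_all _ h0
  refine ⟨⟨hX.aestronglyMeasurable, ?_⟩, ?_⟩
  · rw [hasFiniteIntegral_iff_ofReal h0']
    exact h.trans_lt ENNReal.ofReal_lt_top
  · rw [integral_eq_lintegral_of_nonneg_ae h0' hX.aestronglyMeasurable]
    exact ENNReal.toReal_le_of_le_ofReal hC h

end Limit

/-! ### Almost sure behaviour of the arrival times -/

section Arrivals

variable {Ω : Type*} [MeasurableSpace Ω] {P : Measure Ω} {T : ℕ → Ω → ℝ}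

theorem IsPoissonArrivals.ae_strictMono (hT : IsPoissonArrivals P T) :
    ∀ᵐ ω ∂P, StrictMono (fun k => T k ω) := by
  have : ∀ᵐ ω ∂P, ∀ k, 0 < T (k + 1) ω - T k ω := by
    rw [ae_all_iff]
    intro k
    have h := (hT.law k).map_eq ▸ ae_pos_expMeasure_one
    exact ae_of_ae_map (hT.law k).aemeasurable h
  filter_upwards [this] with ω hω
  exact strictMono_nat_of_lt_succ fun k => sub_pos.1 (hω k)

/-- The strong law applies to the increments cut off at 1, which are bounded with positive mean, and
their partial sums stay below T. -/
theorem IsPoissonArrivals.ae_tendsto_atTop [IsProbabilityMeasure P]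
    (hT : IsPoissonArrivals P T) :
    ∀ᵐ ω ∂P, Tendsto (fun k => T k ω) atTop atTop := by
  have hmin : Measurable (fun x : ℝ => min x 1) := by fun_prop
  set Y : ℕ → Ω → ℝ := fun k ω => min (T (k + 1) ω - T k ω) 1 with hY
  have hpos : ∀ᵐ ω ∂P, 0 < Y 0 ω := by
    filter_upwards [hT.ae_strictMono] with ω hω
    exact lt_min (sub_pos.2 (hω zero_lt_one)) one_pos
  have hYm : ∀ k, Measurable (Y k) := fun k =>
    hmin.comp ((hT.measurable (k + 1)).sub (hT.measurable k))
  have hint : Integrable (Y 0) P := by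
    refine Integrable.of_bound (hYm 0).aestronglyMeasurable 1 ?_
    filter_upwards [hpos] with ω hω
    rw [Real.norm_of_nonneg hω.le]
    exact min_le_right _ _
  have hmean : 0 < ∫ ω, Y 0 ω ∂P := by
    rw [integral_pos_iff_support_of_nonneg_ae (hpos.mono fun _ h => h.le) hint]
    have : P (Function.support (Y 0)) = 1 :=
      mem_ae_iff_prob_eq_one ((hYm 0) (measurableSet_singleton 0).compl) |>.1
        (hpos.mono fun _ h => h.ne')
    simp [this]
  have hident : ∀ k, IdentDistrib (Y k) (Y 0) P P := fun k =>
    IdentDistrib.comp ⟨(hT.law k).aemeasurable, (hT.law 0).aemeasurable,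
      (hT.law k).map_eq.trans (hT.law 0).map_eq.symm⟩ hmin
  have hind : Pairwise (Function.onFun (fun X Z => IndepFun X Z P) Y) := fun i j hij =>
    (hT.indep.indepFun hij).comp hmin hmin
  filter_upwards [strong_law_ae_real Y hint hind hident] with ω hω
  have hsum : Tendsto (fun n : ℕ => ∑ i ∈ Finset.range n, Y i ω) atTop atTop := by
    refine (hω.pos_mul_atTop hmean tendsto_natCast_atTop_atTop).congr' ?_
    filter_upwards [eventually_ne_atTop 0] with n hn
    field_simp
  refine tendsto_atTop_mono (fun n => ?_) hsum
  calc ∑ i ∈ Finset.range n, Y i ω ≤ ∑ i ∈ Finset.range n, (T (i + 1) ω - T i ω) :=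
        Finset.sum_le_sum fun i _ => min_le_left _ _
    _ = T n ω := by rw [Finset.sum_range_sub (fun i => T i ω), hT.zero, sub_zero]

end Arrivals

/-! ### Identification of the paths with the stopped chain -/

section Paths

variable {d : ℕ} {f : EuclideanSpace ℝ (Fin d) → ℝ} {L ρ : ℝ}

theorem drivenChain_stoppedStep_of_le {τ : ℕ → ℝ} {W Z : ℕ → EuclideanSpace ℝ (Fin d)}
    (hτ : Monotone τ)
    (hstep : ∀ k, (τ (k + 1), W (k + 1), Z (k + 1)) = nesterovJump f L ρ (τ (k + 1))
      (nesterovFlow ρ (τ k) (τ (k + 1)) (W k) (Z k)) (Z k)) {t : ℝ} (k : ℕ) (hk : τ k ≤ t) :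
    drivenChain (stoppedStep f L ρ t) (τ 0, W 0, Z 0) (fun i => τ (i + 1) - τ i) k
      = (τ k, W k, Z k) := by
  induction k with
  | zero => rfl
  | succ k ih =>
    simp only [drivenChain, ih ((hτ k.le_succ).trans hk)]
    simp only [stoppedStep, add_sub_cancel, if_pos hk, hstep]

/-- Once stopped at `t`, the chain is frozen: every positive wait overshoots the horizon again, and
the flow over zero time is the identity. -/
theorem drivenChain_stoppedStep_of_lt {τ : ℕ → ℝ} {W Z : ℕ → EuclideanSpace ℝ (Fin d)}
    (hτ : StrictMono τ)
    (hstep : ∀ k, (τ (k + 1), W (k + 1), Z (k + 1)) = nesterovJump f L ρ (τ (k + 1))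
      (nesterovFlow ρ (τ k) (τ (k + 1)) (W k) (Z k)) (Z k)) {t : ℝ} (ht : 0 < t) {k n : ℕ}
    (hk : τ k ≤ t) (hk' : t < τ (k + 1)) (hn : k + 1 ≤ n) :
    drivenChain (stoppedStep f L ρ t) (τ 0, W 0, Z 0) (fun i => τ (i + 1) - τ i) n
      = (t, nesterovFlow ρ (τ k) t (W k) (Z k), Z k) := by
  induction n, hn using Nat.le_induction with
  | base =>
    simp only [drivenChain, drivenChain_stoppedStep_of_le hτ.monotone hstep k hk]
    simp only [stoppedStep, add_sub_cancel, if_neg hk'.not_ge]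
  | succ n _ ih =>
    have hlt : ¬ t + (τ (n + 1) - τ n) ≤ t := by
      have := hτ n.lt_succ_self
      simp only [Nat.succ_eq_add_one] at this
      linarith
    simp only [drivenChain, ih]
    simp only [stoppedStep, if_neg hlt, nesterovFlow_self ht]

theorem eq_of_hasDerivAt_zero_of_tendsto {E : Type*} [NormedAddCommGroup E] [NormedSpace ℝ E]
    {g : ℝ → E} {a b : ℝ} {c : E} (hg : ∀ t ∈ Set.Ioo a b, HasDerivAt g 0 t)
    (hc : Tendsto g (𝓝[>] a) (𝓝 c)) {t : ℝ} (ht : t ∈ Set.Ioo a b) : g t = c := by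
  have hconst : ∀ u ∈ Set.Ioo a b, g u = g t := fun u hu =>
    isOpen_Ioo.is_const_of_deriv_eq_zero isPreconnected_Ioo
      (fun x hx => (hg x hx).differentiableAt.differentiableWithinAt)
      (fun x hx => (hg x hx).deriv) hu ht
  refine tendsto_nhds_unique (tendsto_const_nhds.congr' ?_) hc
  filter_upwards [Ioo_mem_nhdsGT (ht.1.trans ht.2)] with u hu using (hconst u hu).symm

/-- Here z is constant, so t^(2/ρ) (w t - Z) is conserved. When a = 0 this quantity tends to 0, so
the finite right limit of w need not be known. -/
theorem eq_nesterovFlow_of_hasDerivAt (hρ : 0 < ρ) {a b : ℝ} (ha : 0 ≤ a)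
    {w z : ℝ → EuclideanSpace ℝ (Fin d)} {W Z : EuclideanSpace ℝ (Fin d)}
    (hw : ∀ t ∈ Set.Ioo a b, HasDerivAt w ((2 / (ρ * t)) • (z t - w t)) t)
    (hz : ∀ t ∈ Set.Ioo a b, HasDerivAt z ((0 : ℝ) • (w t - z t)) t)
    (hza : Tendsto z (𝓝[>] a) (𝓝 Z))
    (hwa : ∃ A, Tendsto w (𝓝[>] a) (𝓝 A) ∧ (a = 0 ∨ A = W)) {t : ℝ} (ht : t ∈ Set.Ioo a b) :
    w t = nesterovFlow ρ a t W Z ∧ z t = Z := by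
  have hr : 0 < 2 / ρ := by positivity
  have hzc : ∀ t ∈ Set.Ioo a b, z t = Z := fun t ht =>
    eq_of_hasDerivAt_zero_of_tendsto (fun u hu => by simpa using hz u hu) hza ht
  refine ⟨?_, hzc t ht⟩
  have ht0 : 0 < t := ha.trans_lt ht.1
  have hmain : t ^ (2 / ρ) • (w t - Z) = a ^ (2 / ρ) • (W - Z) := by
    refine eq_of_hasDerivAt_zero_of_tendsto (g := fun t => t ^ (2 / ρ) • (w t - Z)) (b := b)
      (fun u hu => ?_) ?_ ht
    · have hu0 : 0 < u := ha.trans_lt hu.1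
      refine ((Real.hasDerivAt_rpow_const (p := 2 / ρ) (Or.inl hu0.ne')).smul
        ((hw u hu).sub_const Z)).congr_deriv ?_
      rw [hzc u hu, Real.rpow_sub_one hu0.ne', smul_smul,
        show u ^ (2 / ρ) * (2 / (ρ * u)) = 2 / ρ * (u ^ (2 / ρ) / u) by field_simp]
      module
    · obtain ⟨A, hA, hA'⟩ := hwa
      have h1 : Tendsto (fun t : ℝ => t ^ (2 / ρ)) (𝓝[>] a) (𝓝 (a ^ (2 / ρ))) :=
        ((Real.continuous_rpow_const hr.le).tendsto a).mono_left nhdsWithin_le_nhds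
      have h2 := h1.smul (hA.sub_const Z)
      rcases hA' with rfl | rfl
      · simpa [Real.zero_rpow hr.ne'] using h2
      · exact h2
  rw [nesterovFlow, Real.div_rpow ha ht0.le, div_eq_inv_mul, mul_smul, ← hmain,
    inv_smul_smul₀ (Real.rpow_pos_of_pos ht0 _).ne', add_sub_cancel]

/-- The value of w at time 0 is unconstrained; replacing it by `z0` is harmless because the flow
from time 0 forgets its starting point. -/
theorem IsContinuizedPath.eq_nesterovFlow (hρ : 0 < ρ) {τ : ℕ → ℝ} (hτ : StrictMono τ)
    (hτ0 : τ 0 = 0) {w z : ℝ → EuclideanSpace ℝ (Fin d)} {z0 : EuclideanSpace ℝ (Fin d)}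
    {γ γ' : ℝ → ℝ}
    (h : IsContinuizedPath f (fun t => 2 / (ρ * t)) (fun _ => 0) γ γ' τ w z)
    (h0 : StartsFrom w z z0) (k : ℕ) {t : ℝ} (ht : t ∈ Set.Ioo (τ k) (τ (k + 1))) :
    w t = nesterovFlow ρ (τ k) t (Function.update (fun k => w (τ k)) 0 z0 k) (z (τ k)) ∧
      z t = z (τ k) := by
  refine eq_nesterovFlow_of_hasDerivAt hρ (hτ0 ▸ hτ.monotone (Nat.zero_le k)) (h.drift_w k)
    (h.drift_z k) ?_ ?_ ht
  · cases k with
    | zero =>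
      rw [hτ0]
      exact h0.rightCont_z.tendsto.mono_left (nhdsWithin_mono _ Set.Ioi_subset_Ici_self)
    | succ k =>
      exact (h.rightCont_z k).tendsto.mono_left (nhdsWithin_mono _ Set.Ioi_subset_Ici_self)
  · cases k with
    | zero =>
      obtain ⟨A, hA⟩ := h0.rightLim_w
      exact ⟨A, by rwa [hτ0], Or.inl hτ0⟩
    | succ k =>
      exact ⟨_, (h.rightCont_w k).tendsto.mono_left
        (nhdsWithin_mono _ Set.Ioi_subset_Ici_self), Or.inr (by simp)⟩

theorem IsContinuizedPath.jump_eq (hρ : 0 < ρ) {τ : ℕ → ℝ} (hτ : StrictMono τ)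
    (hτ0 : τ 0 = 0) {w z : ℝ → EuclideanSpace ℝ (Fin d)} {z0 : EuclideanSpace ℝ (Fin d)}
    (h : IsContinuizedPath f (fun t => 2 / (ρ * t)) (fun _ => 0) (fun _ => 1 / L)
      (fun t => ρ * t / (2 * L)) τ w z)
    (h0 : StartsFrom w z z0) (k : ℕ) :
    (τ (k + 1), w (τ (k + 1)), z (τ (k + 1))) = nesterovJump f L ρ (τ (k + 1))
      (nesterovFlow ρ (τ k) (τ (k + 1)) (Function.update (fun k => w (τ k)) 0 z0 k) (z (τ k)))
      (z (τ k)) := by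
  obtain ⟨wl, zl, hwl, hzl, hw, hz⟩ := h.jump k
  have hk : τ k < τ (k + 1) := hτ k.lt_succ_self
  have hk0 : 0 ≤ τ k := hτ0 ▸ hτ.monotone (Nat.zero_le k)
  have hev : ∀ᶠ u in 𝓝[<] (τ (k + 1)), u ∈ Set.Ioo (τ k) (τ (k + 1)) := Ioo_mem_nhdsLT hk
  have ezl : zl = z (τ k) := tendsto_nhds_unique hzl
    (tendsto_const_nhds.congr' (hev.mono fun u hu => (h.eq_nesterovFlow hρ hτ hτ0 h0 k hu).2.symm))
  have ewl : wl = nesterovFlow ρ (τ k) (τ (k + 1))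
      (Function.update (fun k => w (τ k)) 0 z0 k) (z (τ k)) := by
    refine tendsto_nhds_unique hwl (Tendsto.congr'
      (hev.mono fun u hu => (h.eq_nesterovFlow hρ hτ hτ0 h0 k hu).1.symm) ?_)
    exact (hasDerivAt_nesterovFlow hk0 (hk0.trans_lt hk) hρ _ _).continuousAt.tendsto.mono_left
      nhdsWithin_le_nhds
  rw [nesterovJump, ← ewl, ← ezl, hw, hz]

theorem IsContinuizedPath.eventually_drivenChain_eq (hρ : 0 < ρ) {τ : ℕ → ℝ} (hτ : StrictMono τ)
    (hτ0 : τ 0 = 0) (hτt : Tendsto τ atTop atTop) {w z : ℝ → EuclideanSpace ℝ (Fin d)}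
    {z0 : EuclideanSpace ℝ (Fin d)}
    (h : IsContinuizedPath f (fun t => 2 / (ρ * t)) (fun _ => 0) (fun _ => 1 / L)
      (fun t => ρ * t / (2 * L)) τ w z)
    (h0 : StartsFrom w z z0) {t : ℝ} (ht : 0 < t) :
    ∀ᶠ n in atTop, drivenChain (stoppedStep f L ρ t) (0, z0, z0) (fun i => τ (i + 1) - τ i) n
      = (t, w t, z t) := by
  obtain ⟨k, hk, hk'⟩ : ∃ k, τ k ≤ t ∧ t < τ (k + 1) := by
    have hex : ∃ n, t < τ n := (hτt.eventually_gt_atTop t).exists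
    obtain ⟨k, hk⟩ : ∃ k, Nat.find hex = k + 1 :=
      Nat.exists_eq_succ_of_ne_zero fun h => by
        have := Nat.find_spec hex
        rw [h, hτ0] at this
        exact this.not_gt ht
    exact ⟨k, not_lt.1 (Nat.find_min hex (by omega)), hk ▸ Nat.find_spec hex⟩
  set W := Function.update (fun k => w (τ k)) 0 z0 with hW
  have hstep : ∀ k, (τ (k + 1), W (k + 1), z (τ (k + 1))) = nesterovJump f L ρ (τ (k + 1))
      (nesterovFlow ρ (τ k) (τ (k + 1)) (W k) (z (τ k))) (z (τ k)) := fun k => by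
    rw [← h.jump_eq hρ hτ hτ0 h0 k, hW, Function.update_of_ne (by simp)]
  filter_upwards [eventually_ge_atTop (k + 1)] with n hn
  have hinit : ((0 : ℝ), z0, z0) = (τ 0, W 0, z (τ 0)) := by simp [hW, hτ0, h0.init_z]
  rw [hinit, drivenChain_stoppedStep_of_lt (Z := fun k => z (τ k)) hτ hstep ht hk hk' hn]
  -- If t is itself an arrival time, the formula on the open interval is not available, and the
  -- zero-time flow is used instead.
  rcases hk.eq_or_lt with rfl | hlt
  · have hk0 : k ≠ 0 := by rintro rfl; exact ht.ne' hτ0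
    rw [nesterovFlow_self ht, hW, Function.update_of_ne hk0]
  · obtain ⟨e1, e2⟩ := h.eq_nesterovFlow hρ hτ hτ0 h0 k ⟨hlt, hk'⟩
    rw [← e1, ← e2]

/-- The choice of τ makes `v k` the exact flow up to the next arrival, so the algorithm samples the
continuized dynamics at its jumps. -/
theorem IsDiscreteNesterov.step_eq {τ : ℕ → ℝ} {w v z : ℕ → EuclideanSpace ℝ (Fin d)}
    (h : IsDiscreteNesterov f (fun k => 1 - (τ k / τ (k + 1)) ^ (2 / ρ)) (fun _ => 0)
      (fun _ => 1 / L) (fun k => ρ * τ k / (2 * L)) w v z) (k : ℕ) :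
    (τ (k + 1), w (k + 1), z (k + 1)) = nesterovJump f L ρ (τ (k + 1))
      (nesterovFlow ρ (τ k) (τ (k + 1)) (w k) (z k)) (z k) := by
  have hv : v k = nesterovFlow ρ (τ k) (τ (k + 1)) (w k) (z k) := by
    rw [h.step_v, nesterovFlow]; module
  rw [nesterovJump, ← hv, h.step_w, h.step_z, zero_smul, add_zero]

end Paths

/-! ### Bounds in expectation -/

section Expectation

variable {d : ℕ} {f : EuclideanSpace ℝ (Fin d) → ℝ} {L ρ : ℝ} {wstar : EuclideanSpace ℝ (Fin d)}
  {Ω : Type*} [MeasurableSpace Ω] {P : Measure Ω} [IsProbabilityMeasure P] {T : ℕ → Ω → ℝ}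

theorem IsPoissonArrivals.lintegral_nesterovLyapunov_drivenChain_le (hL : 0 < L) (hρ : 0 < ρ)
    (hf : IsLSmooth L f) (hq : IsQuasarConvex ρ f wstar) (hT : IsPoissonArrivals P T) {t : ℝ}
    (ht : 0 ≤ t) (w0 z0 : EuclideanSpace ℝ (Fin d)) (n : ℕ) :
    ∫⁻ ω, ENNReal.ofReal (nesterovLyapunov f L ρ wstar
        (drivenChain (stoppedStep f L ρ t) (0, w0, z0) (fun i => T (i + 1) ω - T i ω) n)) ∂P
      ≤ ENNReal.ofReal (2 * L * ‖z0 - wstar‖ ^ 2 / ρ ^ 2) := by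
  have := isProbabilityMeasure_expMeasure one_pos
  have hdec := lintegral_drivenChain_le (step := stoppedStep f L ρ t) (x0 := (0, w0, z0))
    (V := fun x => ENNReal.ofReal (nesterovLyapunov f L ρ wstar x))
    (A := {x | x.1 ∈ Set.Icc 0 t}) (B := Set.Ioi 0)
    (measurable_stoppedStep f L ρ t) (fun i => (hT.measurable (i + 1)).sub (hT.measurable i))
    hT.indep hT.law (measurable_nesterovLyapunov hf).ennreal_ofReal ⟨le_rfl, ht⟩
    ae_pos_expMeasure_one ?_
    (fun x hx => lintegral_nesterovLyapunov_stoppedStep_le hL hρ hf hq x hx) n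
  · refine hdec.trans (ENNReal.ofReal_le_ofReal (le_of_eq ?_))
    simp only [nesterovLyapunov]; ring
  · intro x hx e he
    simp only [stoppedStep, nesterovJump]
    split_ifs with h
    · exact ⟨add_nonneg hx.1 (le_of_lt he), h⟩
    · exact ⟨ht, le_rfl⟩

/-- If a random state is the eventual value of a sequence of stopped chains, the Lyapunov bound
passes to its objective gap. -/
theorem IsPoissonArrivals.integrable_and_integral_le (hL : 0 < L) (hρ : 0 < ρ)
    (hf : IsLSmooth L f) (hq : IsQuasarConvex ρ f wstar) (hT : IsPoissonArrivals P T)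
    {t : ℕ → ℝ} (ht : ∀ n, 0 ≤ t n) (w0 z0 : EuclideanSpace ℝ (Fin d)) (m : ℕ → ℕ)
    {s : Ω → ℝ} {w z : Ω → EuclideanSpace ℝ (Fin d)}
    (h : ∀ᵐ ω ∂P, ∀ᶠ n in atTop, drivenChain (stoppedStep f L ρ (t n)) (0, w0, z0)
      (fun i => T (i + 1) ω - T i ω) (m n) = (s ω, w ω, z ω)) :
    Integrable (fun ω => s ω ^ 2 * (f (w ω) - f wstar)) P ∧
      ∫ ω, s ω ^ 2 * (f (w ω) - f wstar) ∂P ≤ 2 * L * ‖z0 - wstar‖ ^ 2 / ρ ^ 2 := by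
  have hmeas : ∀ n, Measurable fun ω => drivenChain (stoppedStep f L ρ (t n)) (0, w0, z0)
      (fun i => T (i + 1) ω - T i ω) (m n) := fun n =>
    measurable_drivenChain (measurable_stoppedStep f L ρ (t n))
      (fun i => (hT.measurable (i + 1)).sub (hT.measurable i)) (m n)
  -- The random state is not assumed measurable; it is an almost sure limit of measurable chain
  -- states.
  have hstate : AEMeasurable (fun ω => (s ω, w ω, z ω)) P :=
    aemeasurable_of_tendsto_metrizable_ae' (fun n => (hmeas n).aemeasurable)
      (h.mono fun ω hω => tendsto_const_nhds.congr' (hω.mono fun n hn => hn.symm))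
  have hgap : Measurable (fun x : ℝ × EuclideanSpace ℝ (Fin d) × EuclideanSpace ℝ (Fin d) =>
      x.1 ^ 2 * (f x.2.1 - f wstar)) := by
    have := hf.differentiable.continuous.measurable
    fun_prop
  refine integrable_and_integral_le_of_lintegral_le (hgap.comp_aemeasurable hstate)
    (fun ω => mul_nonneg (sq_nonneg _) (sub_nonneg.2 (hq.isMin _))) (by positivity) ?_
  refine le_trans (lintegral_mono fun ω => ENNReal.ofReal_le_ofReal ?_)
    (lintegral_le_of_eventually_eq (measurable_nesterovLyapunov (ρ := ρ) (wstar := wstar)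
      hf).ennreal_ofReal hmeas h
      fun n => hT.lintegral_nesterovLyapunov_drivenChain_le hL hρ hf hq (ht n) w0 z0 (m n))
  exact le_add_of_nonneg_right (by positivity)

end Expectation

/-! ### The two convergence rates -/

theorem theorem1 {d : ℕ} (f : EuclideanSpace ℝ (Fin d) → ℝ) (wstar : EuclideanSpace ℝ (Fin d))
    (L ρ : ℝ) (hL : 0 < L) (hρ : 0 < ρ)
    (hsmooth : IsLSmooth L f) (hquasar : IsQuasarConvex ρ f wstar)
    {Ω : Type*} [MeasurableSpace Ω] (P : Measure Ω) [IsProbabilityMeasure P]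
    (T : ℕ → Ω → ℝ) (hT : IsPoissonArrivals P T) :
    (∀ (w z : ℝ → Ω → EuclideanSpace ℝ (Fin d)) (z0 : EuclideanSpace ℝ (Fin d)),
      (∀ᵐ ω ∂P,
        IsContinuizedPath f (fun t => 2 / (ρ * t)) (fun _ => 0) (fun _ => 1 / L)
          (fun t => ρ * t / (2 * L)) (fun k => T k ω) (fun t => w t ω) (fun t => z t ω) ∧
        StartsFrom (fun t => w t ω) (fun t => z t ω) z0) →
      ∀ t : ℝ, 0 < t →
        Integrable (fun ω => f (w t ω) - f wstar) P ∧
        ∫ ω, (f (w t ω) - f wstar) ∂P ≤ 2 * L * ‖z0 - wstar‖ ^ 2 / (ρ ^ 2 * t ^ 2)) ∧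
    (∀ (w v z : ℕ → Ω → EuclideanSpace ℝ (Fin d)) (w0 z0 : EuclideanSpace ℝ (Fin d)),
      (∀ᵐ ω ∂P,
        IsDiscreteNesterov f (fun k => 1 - (T k ω / T (k + 1) ω) ^ (2 / ρ)) (fun _ => 0)
          (fun _ => 1 / L) (fun k => ρ * T k ω / (2 * L))
          (fun k => w k ω) (fun k => v k ω) (fun k => z k ω) ∧
        w 0 ω = w0 ∧ z 0 ω = z0) →
      ∀ k : ℕ,
        Integrable (fun ω => T k ω ^ 2 * (f (w k ω) - f wstar)) P ∧
        ∫ ω, T k ω ^ 2 * (f (w k ω) - f wstar) ∂P ≤ 2 * L * ‖z0 - wstar‖ ^ 2 / ρ ^ 2) := by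

  refine ⟨fun w z z0 h t ht => ?_, fun w v z w0 z0 h k => ?_⟩
  · have hev : ∀ᵐ ω ∂P, ∀ᶠ n in atTop, drivenChain (stoppedStep f L ρ t) (0, z0, z0)
        (fun i => T (i + 1) ω - T i ω) n = (t, w t ω, z t ω) := by
      filter_upwards [h, hT.ae_strictMono, hT.ae_tendsto_atTop] with ω hω hmono htop
      exact hω.1.eventually_drivenChain_eq hρ hmono (hT.zero ω) htop hω.2 ht
    obtain ⟨hi, hle⟩ := hT.integrable_and_integral_le hL hρ hsmooth hquasar (t := fun _ => t)
      (fun _ => ht.le) z0 z0 id hev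
    have ht2 : 0 < t ^ 2 := by positivity
    refine ⟨(hi.const_mul (t ^ 2)⁻¹).congr
      (ae_of_all _ fun ω => inv_mul_cancel_left₀ ht2.ne' _), ?_⟩
    rw [integral_const_mul] at hle
    rwa [← div_div, le_div_iff₀' ht2]
  -- `T k` is unbounded, so no single horizon suffices; along the horizons n, almost every path is
  -- eventually unstopped through step k.
  · refine hT.integrable_and_integral_le hL hρ hsmooth hquasar (t := fun n : ℕ => (n : ℝ))
      (fun n => n.cast_nonneg) w0 z0 (fun _ => k) (z := z k) ?_
    filter_upwards [h, hT.ae_strictMono] with ω ⟨hω, hw0, hz0⟩ hmono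
    filter_upwards [(tendsto_natCast_atTop_atTop (R := ℝ)).eventually_ge_atTop (T k ω)] with n hn
    have hinit : ((0 : ℝ), w0, z0) = (T 0 ω, w 0 ω, z 0 ω) := by rw [hT.zero, hw0, hz0]
    rw [hinit]
    exact drivenChain_stoppedStep_of_le (τ := fun i => T i ω) (W := fun i => w i ω)
      (Z := fun i => z i ω) hmono.monotone hω.step_eq k hn
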